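/- Theorem 3.2 (thm:diag). Let $p$ be a prime, $r\ge 1$, $q=p^{2r}$, let $d$ be a positive divisor of $p^r+1$, and let $s\ge 1$. For $k\ge 1$ let $N'_{k,s}$ be the number of points $(x_0:\dots:x_s)\in\mathbb P^s(\mathbb F_{q^k})$ with $x_0^d+x_1^d+\cdots+x_s^d=0$, and let \[ Z_s(t)=\exp\Big(\sum_{k=1}^{\infty}N'_{k,s}\,\frac{t^k}{k}\Big)\in\mathbb Q[[t]] \] be the zeta function over $\mathbb F_q$ of this diagonal hypersurface. Put $B(d,m)=\frac1d\big((d-1)^m+(-1)^m(d-1)\big)$. Then $B(d,s+1)$ is a non-negative integer and, as formal power series, \[ Z_s(t)=\begin{cases} \dfrac{(1+q^{(s-1)/2}t)^{B(d,s+1)}}{\prod_{i=0}^{s-1}(1-q^it)}, & s \text{ even},\\[3mm] \dfrac{1}{(1-q^{(s-1)/2}t)^{B(d,s+1)}\prod_{i=0}^{s-1}(1-q^it)}, & s\text{ odd}, \end{cases} \] where $q^{(s-1)/2}=p^{r(s-1)}$. -/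

import Mathlib

namespace DiagonalZeta

open scoped LinearAlgebra.Projectivization

/-- `B(d, s) = ((d - 1)^s + (-1)^s (d - 1)) / d`, as a rational number. -/
def B (d s : ℕ) : ℚ :=
  (((d : ℚ) - 1) ^ s + (-1) ^ s * ((d : ℚ) - 1)) / d

/-- The diagonal form `x_0^d + ⋯ + x_s^d` with coefficients in `F`. -/
noncomputable def diagonalForm (F : Type*) [Field F] (d s : ℕ) :
    MvPolynomial (Fin (s + 1)) F :=
  ∑ i, MvPolynomial.X i ^ d

/-- The `K`-points of the projective hypersurface `f = 0` in `ℙ^s`, for a homogeneous form `f` over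
`F` and a field extension `K` of `F`: the lines of `K^(s+1)` through the origin on which `f`
vanishes. -/
def hypersurfacePoints {F : Type*} [Field F] {s : ℕ} (f : MvPolynomial (Fin (s + 1)) F)
    (K : Type*) [Field K] [Algebra F K] : Set (ℙ K (Fin (s + 1) → K)) :=
  {P | ∀ v ∈ P.submodule, MvPolynomial.aeval v f = 0}

/-- The number of points of the projective hypersurface `f = 0` over the extension of degree `k`
of the finite field `F`. -/
noncomputable def pointCount {F : Type*} [Field F] [Finite F] (p : ℕ) [Fact p.Prime] [CharP F p]
    {s : ℕ} (f : MvPolynomial (Fin (s + 1)) F) (k : ℕ) [NeZero k] : ℕ :=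
  Nat.card (hypersurfacePoints f (FiniteField.Extension F p k))

/-- The formal power series `∑_{k ≥ 1} N_k t^k / k`, where `N_k` is the number of points over the
extension of degree `k`. -/
noncomputable def logZeta {F : Type*} [Field F] [Finite F] (p : ℕ) [Fact p.Prime] [CharP F p]
    {s : ℕ} (f : MvPolynomial (Fin (s + 1)) F) : PowerSeries ℚ :=
  PowerSeries.mk fun n =>
    match n with
    | 0 => 0
    | k + 1 => (pointCount p f (k + 1) : ℚ) / ((k + 1 : ℕ) : ℚ)

/-- The zeta function `exp (∑_{k ≥ 1} N_k t^k / k)` of the projective hypersurface `f = 0` over the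
finite field `F` of characteristic `p`, as a formal power series. -/
noncomputable def zeta {F : Type*} [Field F] [Finite F] (p : ℕ) [Fact p.Prime] [CharP F p]
    {s : ℕ} (f : MvPolynomial (Fin (s + 1)) F) : PowerSeries ℚ :=
  (PowerSeries.exp ℚ).subst (logZeta p f)

/-- The substitution in the definition of `zeta` is legitimate: the series has no constant term. -/
theorem hasSubst_logZeta {F : Type*} [Field F] [Finite F] (p : ℕ) [Fact p.Prime] [CharP F p]
    {s : ℕ} (f : MvPolynomial (Fin (s + 1)) F) : PowerSeries.HasSubst (logZeta p f) := by
  apply PowerSeries.HasSubst.of_constantCoeff_zero'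
  simp [logZeta, ← PowerSeries.coeff_zero_eq_constantCoeff_apply]

end DiagonalZeta

/-! Write `u = p ^ r` and let `K` be the extension of degree `k`, with `Q = u ^ (2 k)` elements.
Orthogonality of additive characters gives `Q` times the number of affine solutions as the sum over
`a` of `S_d(a) ^ (s + 1)`, where `S_d(a) = ∑ x, ψ (a x ^ d)` (`card_mul_card_diagonal`). For `d ∣ u
+ 1` and `a ≠ 0` these sums take only the values `(-1) ^ k u ^ k` and `(-1) ^ k u ^ k (1 - d)`
(`powSum_eq`).

This is proved without Gauss sums. For exponent `u + 1` the sums are real and, off one class of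
units, have square `Q`, because `x ^ (u + 1)` is quadratic for the `u`-Frobenius
(`powSum_mul_powSum_neg`). The first two moments then fix all values up to one global sign
(`two_valued_of_moments`), and a congruence modulo `u + 1` fixes the sign
(`eq_neg_one_pow_of_isIntegral`). Averaging passes to the divisors `d` of `u + 1`.

The point count becomes a combination of `k`-th powers, which are the coefficients of the
logarithmic derivative of the claimed rational function. -/

namespace DiagonalZeta

/-! ### Power maps on finite cyclic groups. -/

section Cyclic

variable {G : Type*} [CommGroup G] [IsCyclic G] [Finite G]

/-- In a finite cyclic group of order `n * m`, the `n`-th powers are the `m`-torsion elements. -/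
theorem exists_pow_eq_iff {n m : ℕ} (h : n * m = Nat.card G) (c : G) :
    (∃ y, y ^ n = c) ↔ c ^ m = 1 := by
  have hpos : 0 < Nat.card G := Nat.card_pos
  have hn : 0 < n := Nat.pos_of_ne_zero (by rintro rfl; simp at h; omega)
  have hm : 0 < m := Nat.pos_of_ne_zero (by rintro rfl; simp at h; omega)
  have hle : (powMonoidHom n : G →* G).range ≤ (powMonoidHom m : G →* G).ker := by
    rintro _ ⟨y, rfl⟩
    rw [MonoidHom.mem_ker, powMonoidHom_apply, powMonoidHom_apply, ← pow_mul, h, pow_card_eq_one']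
  have heq : (powMonoidHom n : G →* G).range = (powMonoidHom m : G →* G).ker := by
    apply Subgroup.eq_of_le_of_card_ge hle
    rw [IsCyclic.card_powMonoidHom_range, IsCyclic.card_powMonoidHom_ker, ← h,
      Nat.gcd_eq_right (Dvd.intro _ rfl), Nat.gcd_eq_right (Dvd.intro_left _ rfl),
      Nat.mul_div_cancel_left _ hn]
  constructor
  · rintro ⟨y, rfl⟩
    rw [← pow_mul, h, pow_card_eq_one']
  · intro hc
    have : c ∈ (powMonoidHom m : G →* G).ker := hc
    rw [← heq] at this
    exact this

theorem card_pow_eq_pow {n : ℕ} (h : n ∣ Nat.card G) (c : G) :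
    Nat.card {x : G // x ^ n = c ^ n} = n := by
  have : Nat.card {x : G // x ^ n = c ^ n} = Nat.card (powMonoidHom n : G →* G).ker := by
    refine Nat.card_congr ((Equiv.mulRight c⁻¹).subtypeEquiv fun x => ?_)
    simp [MonoidHom.mem_ker, mul_pow, mul_inv_eq_one]
  rw [this, IsCyclic.card_powMonoidHom_ker, Nat.gcd_eq_right h]

theorem card_pow_eq {n m : ℕ} (h : n * m = Nat.card G) {c : G} (hc : c ^ m = 1) :
    Nat.card {x : G // x ^ n = c} = n := by
  obtain ⟨y, rfl⟩ := (exists_pow_eq_iff h c).2 hc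
  exact card_pow_eq_pow (Dvd.intro _ h) y

end Cyclic

/-! ### Exponential sums of monomials and their moments. -/

section CharSum

set_option linter.unusedSectionVars false

variable {K : Type*} [Field K] [Fintype K] [DecidableEq K]

/-- The exponential sum `∑ x, ψ (a x ^ d)`. -/
noncomputable def powSum (ψ : AddChar K ℂ) (d : ℕ) (a : K) : ℂ :=
  ∑ x : K, ψ (a * x ^ d)

theorem powSum_mul_pow (ψ : AddChar K ℂ) (d : ℕ) (a : K) (y : Kˣ) :
    powSum ψ d (a * (y : K) ^ d) = powSum ψ d a := by
  unfold powSum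
  refine Fintype.sum_equiv (Units.mulLeft y) _ _ fun x => ?_
  simp [mul_pow, mul_assoc]

/-- The sum depends only on the class of `a` modulo `d`-th powers, and `a ^ n` detects that class.
-/
theorem powSum_eq_of_pow_eq (ψ : AddChar K ℂ) {d n : ℕ} (h : d * n = Nat.card Kˣ) {a b : Kˣ}
    (hab : a ^ n = b ^ n) : powSum ψ d (a : K) = powSum ψ d (b : K) := by
  obtain ⟨y, hy⟩ := (exists_pow_eq_iff h (a / b)).2 (by rw [div_pow, hab, div_self'])
  have : (a : K) = b * (y : K) ^ d := by
    rw [← Units.val_pow_eq_pow_val, hy, ← Units.val_mul, mul_div_cancel]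
  rw [this, powSum_mul_pow]

theorem sum_mul_eq_ite {ψ : AddChar K ℂ} (hψ : ψ.IsPrimitive) (b : K) :
    ∑ a : K, ψ (a * b) = if b = 0 then (Fintype.card K : ℂ) else 0 := by
  simpa using AddChar.sum_mulShift b hψ

theorem powSum_zero (ψ : AddChar K ℂ) (d : ℕ) : powSum ψ d 0 = Fintype.card K := by
  simp [powSum]

/-- Splitting a sum over a finite field at zero. -/
theorem sum_eq_zero_add_sum_units {M : Type*} [AddCommMonoid M] (f : K → M) :
    ∑ x, f x = f 0 + ∑ x : Kˣ, f x := by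
  rw [Fintype.sum_eq_add_sum_compl (0 : K)]
  congr 1
  symm
  refine Finset.sum_bij (fun (x : Kˣ) _ => (x : K)) (by simp) (fun _ _ _ _ h => Units.ext h)
    (fun b hb => ⟨Units.mk0 b (by simpa using hb), by simp, rfl⟩) (by simp)

theorem sum_powSum {ψ : AddChar K ℂ} (hψ : ψ.IsPrimitive) {d : ℕ} (hd : d ≠ 0) :
    ∑ a : K, powSum ψ d a = Fintype.card K := by
  unfold powSum
  rw [Finset.sum_comm]
  simp [sum_mul_eq_ite hψ, hd]

theorem sum_units_powSum {ψ : AddChar K ℂ} (hψ : ψ.IsPrimitive) {d : ℕ} (hd : d ≠ 0) :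
    ∑ a : Kˣ, powSum ψ d (a : K) = 0 := by
  have := sum_eq_zero_add_sum_units (powSum ψ d)
  rw [sum_powSum hψ hd, powSum_zero] at this
  simpa using this

/-- Source of the second moment: orthogonality in `a` leaves only the pairs with equal `d`-th
powers. -/
theorem sum_powSum_mul_neg {ψ : AddChar K ℂ} (hψ : ψ.IsPrimitive) (d : ℕ) :
    ∑ a : K, powSum ψ d a * powSum ψ d (-a) =
      Fintype.card K * ∑ x : K, ∑ y : K, if x ^ d = y ^ d then (1 : ℂ) else 0 := by
  have : ∀ a : K, powSum ψ d a * powSum ψ d (-a) =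
      ∑ x : K, ∑ y : K, ψ (a * (x ^ d - y ^ d)) := by
    intro a
    unfold powSum
    rw [Finset.sum_mul_sum]
    refine Finset.sum_congr rfl fun x _ => Finset.sum_congr rfl fun y _ => ?_
    rw [← AddChar.map_add_eq_mul]
    congr 1
    ring
  simp_rw [this]
  rw [Finset.sum_comm, Finset.mul_sum]
  refine Finset.sum_congr rfl fun x _ => ?_
  rw [Finset.sum_comm, Finset.mul_sum]
  refine Finset.sum_congr rfl fun y _ => ?_
  rw [sum_mul_eq_ite hψ]
  simp [sub_eq_zero]

theorem sum_pow_eq_pow {d : ℕ} (hd : d ∣ Nat.card Kˣ) :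
    (∑ x : K, ∑ y : K, if x ^ d = y ^ d then (1 : ℂ) else 0) = 1 + Nat.card Kˣ * d := by
  have hd0 : d ≠ 0 := by rintro rfl; exact Nat.card_pos.ne' (Nat.eq_zero_of_zero_dvd hd)
  rw [sum_eq_zero_add_sum_units]
  congr 1
  · simp [hd0, eq_comm (a := (0 : K))]
  · have : ∀ x : Kˣ, (∑ y : K, if (x : K) ^ d = y ^ d then (1 : ℂ) else 0) = d := by
      intro x
      rw [sum_eq_zero_add_sum_units]
      have h0 : ¬ ((x : K) ^ d = 0 ^ d) := by simp [hd0]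
      rw [if_neg h0, zero_add, Finset.sum_boole]
      norm_cast
      conv_rhs => rw [← card_pow_eq_pow hd x]
      rw [Nat.card_eq_fintype_card, Fintype.card_subtype]
      congr 1
      ext y
      simp only [Finset.mem_filter, Finset.mem_univ, true_and]
      exact eq_comm
    simp_rw [this]
    simp [Nat.card_eq_fintype_card]

theorem sum_units_powSum_mul_neg {ψ : AddChar K ℂ} (hψ : ψ.IsPrimitive) {d : ℕ}
    (hd : d ∣ Nat.card Kˣ) :
    ∑ a : Kˣ, powSum ψ d (a : K) * powSum ψ d (-(a : K)) =
      Fintype.card K * (Nat.card Kˣ * (d - 1)) := by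
  have h := sum_eq_zero_add_sum_units (fun a : K => powSum ψ d a * powSum ψ d (-a))
  rw [sum_powSum_mul_neg hψ, sum_pow_eq_pow hd, neg_zero, powSum_zero] at h
  have hc : (Fintype.card K : ℂ) = Nat.card Kˣ + 1 := by
    rw [Nat.card_eq_fintype_card, ← Nat.cast_add_one, ← Fintype.card_eq_card_units_add_one]
  linear_combination -h - (Fintype.card K : ℂ) * hc

theorem conj_powSum (ψ : AddChar K ℂ) (d : ℕ) (a : K) :
    (starRingEnd ℂ) (powSum ψ d a) = powSum ψ d (-a) := by
  unfold powSum
  rw [map_sum]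
  refine Finset.sum_congr rfl fun x _ => ?_
  rw [← AddChar.map_neg_eq_conj, neg_mul]

theorem addChar_sum_eq_prod {ι A M : Type*} [AddCommMonoid A] [CommMonoid M] (ψ : AddChar A M)
    (s : Finset ι) (f : ι → A) : ψ (∑ i ∈ s, f i) = ∏ i ∈ s, ψ (f i) := by
  classical
  induction s using Finset.induction_on with
  | empty => simp
  | insert i s hi ih => rw [Finset.sum_insert hi, Finset.prod_insert hi, AddChar.map_add_eq_mul, ih]

/-- The number of solutions of a diagonal equation in terms of exponential sums. -/
theorem card_mul_card_diagonal {ψ : AddChar K ℂ} (hψ : ψ.IsPrimitive) (d m : ℕ) :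
    (Fintype.card K : ℂ) * Nat.card {v : Fin m → K // ∑ i, v i ^ d = 0} =
      ∑ a : K, powSum ψ d a ^ m := by
  have : ∀ a : K, powSum ψ d a ^ m = ∑ v : Fin m → K, ψ (a * ∑ i, v i ^ d) := by
    intro a
    unfold powSum
    rw [← Fin.prod_const, Finset.prod_univ_sum, Fintype.piFinset_univ]
    refine Finset.sum_congr rfl fun v _ => ?_
    rw [Finset.mul_sum, addChar_sum_eq_prod]
  simp_rw [this]
  rw [Finset.sum_comm]
  simp_rw [sum_mul_eq_ite hψ]
  rw [Finset.sum_ite, Finset.sum_const, Finset.sum_const_zero, add_zero, nsmul_eq_mul, mul_comm,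
    Nat.card_eq_fintype_card, Fintype.card_subtype]

end CharSum

/-! ### Evaluation of the sums of exponent `p ^ r + 1`. -/

section SemiPrimitive

set_option linter.unusedSectionVars false

/-- A function of mean zero with prescribed second moment which has constant absolute value off a
small set on which it is constant takes only two values. -/
theorem two_valued_of_moments {ι : Type*} [Fintype ι] (P : ι → Prop) [DecidablePred P]
    {n : ℕ} (hn : 0 < n) {u R : ℝ} (hu : 0 < u) (g : ι → ℝ)
    (hcard : (Fintype.card ι : ℝ) = n * (u + 1)) (hP : (Finset.univ.filter P).card = n)
    (hconst : ∀ a b, P a → P b → g a = g b) (hsq : ∀ a, ¬ P a → g a ^ 2 = R ^ 2)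
    (hsum : ∑ a, g a = 0) (hsum2 : ∑ a, g a ^ 2 = R ^ 2 * (n * (u + 1) * u)) :
    ∃ ε : ℤ, (ε = 1 ∨ ε = -1) ∧ ∀ a, g a = ε * R * (if P a then -u else 1) := by
  have hn' : (0 : ℝ) < n := by exact_mod_cast hn
  obtain ⟨a₀, ha₀⟩ : (Finset.univ.filter P).Nonempty := Finset.card_pos.1 (by omega)
  have ha₀ : P a₀ := by simpa using ha₀
  have hcompl : ((Finset.univ.filter fun a => ¬ P a).card : ℝ) = n * u := by
    have := Finset.card_filter_add_card_filter_not (s := (Finset.univ : Finset ι)) P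
    rw [hP, Finset.card_univ] at this
    have : (n : ℝ) + ((Finset.univ.filter fun a => ¬ P a).card : ℝ) = Fintype.card ι := by
      exact_mod_cast this
    linarith
  have hval : ∀ a ∈ Finset.univ.filter P, g a = g a₀ := fun a ha =>
    hconst a a₀ (by simpa using ha) ha₀
  have hval2 : ∀ a ∈ Finset.univ.filter P, g a ^ 2 = g a₀ ^ 2 := fun a ha => by rw [hval a ha]
  have hoff2 : ∑ a ∈ Finset.univ.filter (fun a => ¬ P a), g a ^ 2 = n * u * R ^ 2 := by
    rw [Finset.sum_congr rfl fun a ha => hsq a (by simpa using ha), Finset.sum_const,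
      nsmul_eq_mul, hcompl]
  rw [← Finset.sum_filter_add_sum_filter_not _ P, Finset.sum_congr rfl hval2, Finset.sum_const, hP,
    nsmul_eq_mul, hoff2] at hsum2
  rw [← Finset.sum_filter_add_sum_filter_not _ P, Finset.sum_congr rfl hval, Finset.sum_const, hP,
    nsmul_eq_mul] at hsum
  have hF : g a₀ ^ 2 = (u * R) ^ 2 := by
    apply mul_left_cancel₀ hn'.ne'
    linear_combination hsum2
  -- Equality case of Cauchy–Schwarz: the mean and mean square of `g` off `P` leave no variance
  -- around `-g a₀ / u`.
  have hzero : ∑ a ∈ Finset.univ.filter (fun a => ¬ P a), (u * g a + g a₀) ^ 2 = 0 := by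
    have : ∀ a, (u * g a + g a₀) ^ 2 = u ^ 2 * g a ^ 2 + 2 * u * g a₀ * g a + g a₀ ^ 2 :=
      fun a => by ring
    simp_rw [this]
    rw [Finset.sum_add_distrib, Finset.sum_add_distrib, ← Finset.mul_sum, ← Finset.mul_sum, hoff2,
      Finset.sum_const, nsmul_eq_mul, hcompl]
    linear_combination 2 * u * g a₀ * hsum - n * u * hF
  have hoff : ∀ a, ¬ P a → u * g a = - g a₀ := fun a ha => by
    have := (Finset.sum_eq_zero_iff_of_nonneg fun _ _ => sq_nonneg _).1 hzero a (by simpa using ha)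
    linarith [pow_eq_zero_iff (two_ne_zero) |>.1 this]
  rcases sq_eq_sq_iff_eq_or_eq_neg.1 hF with h | h
  · refine ⟨-1, Or.inr rfl, fun a => ?_⟩
    split_ifs with ha
    · rw [hconst a a₀ ha ha₀, h]; push_cast; ring
    · apply mul_left_cancel₀ hu.ne'
      rw [hoff a ha, h]; push_cast; ring
  · refine ⟨1, Or.inl rfl, fun a => ?_⟩
    split_ifs with ha
    · rw [hconst a a₀ ha ha₀, h]; push_cast; ring
    · apply mul_left_cancel₀ hu.ne'
      rw [hoff a ha, h]; push_cast; ring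

variable {K : Type*} [Field K] [Fintype K] [DecidableEq K]

/-- The trace to the prime field is Frobenius-invariant and surjective; compose it with an injective
character of `ZMod p`. -/
theorem exists_frobenius_invariant_addChar (K : Type*) [Field K] [Finite K] (p : ℕ)
    [Fact p.Prime] [CharP K p] :
    ∃ ψ : AddChar K ℂ, ψ.IsPrimitive ∧ ∀ z, ψ (z ^ p) = ψ z := by
  let := ZMod.algebra K p
  refine ⟨(ZMod.stdAddChar (N := p)).compAddMonoidHom
    (Algebra.trace (ZMod p) K).toAddMonoidHom, AddChar.IsPrimitive.of_ne_one ?_, fun z => ?_⟩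
  · intro h
    obtain ⟨x, hx⟩ := Algebra.trace_surjective (ZMod p) K 1
    have h1 : (ZMod.stdAddChar (N := p)) 1 = 1 := by
      have := DFunLike.congr_fun h x
      simpa [hx] using this
    have h0 := ZMod.injective_stdAddChar (N := p) (h1.trans (AddChar.map_zero_eq_one _).symm)
    exact one_ne_zero h0
  · have := Algebra.trace_eq_of_algEquiv (FiniteField.frobeniusAlgEquiv (ZMod p) K p) z
    simp [ZMod.card] at this
    simp [this]

theorem addChar_pow_char_pow {ψ : AddChar K ℂ} {p : ℕ} (h : ∀ z, ψ (z ^ p) = ψ z) (r : ℕ) (z : K) :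
    ψ (z ^ p ^ r) = ψ z := by
  induction r with
  | zero => simp
  | succ r ih => rw [pow_succ, pow_mul, h, ih]

/-- Shift `x` to `x + y`. As `u`-th powers are additive, the terms in `y` are `a x ^ u y` and `a x y
^ u`; invariance of `ψ` replaces the first by its `u`-th power, so everything is linear in `y ^ u`.
Summing over `y` kills each `x` that is not a root of `a ^ u x ^ (u ^ 2) + a x`, leaving `x = 0`. -/
theorem powSum_mul_powSum_neg {p : ℕ} [Fact p.Prime] [CharP K p] {ψ : AddChar K ℂ}
    (hψ : ψ.IsPrimitive) (hfrob : ∀ z, ψ (z ^ p) = ψ z) {r u : ℕ} (hu : u = p ^ r) {a : K}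
    (ha : ∀ x : K, x ≠ 0 → a ^ u * x ^ u ^ 2 + a * x ≠ 0) :
    powSum ψ (u + 1) a * powSum ψ (u + 1) (-a) = Fintype.card K := by
  have hfr : ∀ z, ψ (z ^ u) = ψ z := fun z => by rw [hu, addChar_pow_char_pow hfrob]
  have hadd : ∀ x y : K, (x + y) ^ u = x ^ u + y ^ u := fun x y => by
    rw [hu, add_pow_char_pow]
  have hbij : Function.Bijective fun y : K => y ^ u := by
    apply Finite.injective_iff_bijective.1
    intro x y hxy
    simp only [hu] at hxy
    exact iterateFrobenius_inj K p r (by simpa [iterateFrobenius_def] using hxy)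
  have hterm : ∀ x y : K, ψ (a * (x + y) ^ (u + 1)) * ψ (-a * y ^ (u + 1)) =
      ψ (a * x ^ (u + 1)) * ψ (y ^ u * (a ^ u * x ^ u ^ 2 + a * x)) := by
    intro x y
    have h1 : a * (x + y) ^ (u + 1) + -a * y ^ (u + 1) =
        a * x ^ (u + 1) + (a * x ^ u * y + y ^ u * (a * x)) := by
      rw [pow_succ, hadd]; ring
    have h2 : (a * x ^ u * y) ^ u = y ^ u * (a ^ u * x ^ u ^ 2) := by
      rw [mul_pow, mul_pow, ← pow_mul, sq]; ring
    rw [← AddChar.map_add_eq_mul, h1, AddChar.map_add_eq_mul, AddChar.map_add_eq_mul,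
      ← hfr (a * x ^ u * y), h2, mul_add, AddChar.map_add_eq_mul]
  unfold powSum
  calc (∑ x : K, ψ (a * x ^ (u + 1))) * ∑ y : K, ψ (-a * y ^ (u + 1))
      = ∑ y : K, ∑ x : K, ψ (a * (x + y) ^ (u + 1)) * ψ (-a * y ^ (u + 1)) := by
        rw [Finset.sum_mul_sum, Finset.sum_comm]
        refine Finset.sum_congr rfl fun y _ => ?_
        exact (Fintype.sum_equiv (Equiv.addRight y) _ _ fun x => rfl).symm
    _ = ∑ x : K, ψ (a * x ^ (u + 1)) * ∑ y : K, ψ (y * (a ^ u * x ^ u ^ 2 + a * x)) := by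
        rw [Finset.sum_comm]
        refine Finset.sum_congr rfl fun x _ => ?_
        rw [Finset.mul_sum]
        simp_rw [hterm]
        exact Function.Bijective.sum_comp hbij
          fun y => ψ (a * x ^ (u + 1)) * ψ (y * (a ^ u * x ^ u ^ 2 + a * x))
    _ = Fintype.card K := by
        simp_rw [sum_mul_eq_ite hψ]
        have hu0 : u ≠ 0 := by rw [hu]; exact pow_ne_zero _ (Fact.out : p.Prime).ne_zero
        rw [Finset.sum_eq_single 0]
        · simp [hu0]
        · intro x _ hx
          rw [if_neg (ha x hx), mul_zero]
        · simp

theorem isIntegral_addChar {p : ℕ} [Fact p.Prime] [CharP K p] (ψ : AddChar K ℂ) (x : K) :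
    IsIntegral ℤ (ψ x) := by
  refine IsIntegral.of_pow (Fact.out : p.Prime).pos ?_
  rw [← AddChar.map_nsmul_eq_pow]
  simp [isIntegral_one]

/-- A power sum is congruent to `1` modulo the exponent. -/
theorem exists_isIntegral_powSum {p : ℕ} [Fact p.Prime] [CharP K p] (ψ : AddChar K ℂ) {d n : ℕ}
    (h : d * n = Nat.card Kˣ) (a : K) :
    ∃ z : ℂ, IsIntegral ℤ z ∧ powSum ψ d a = 1 + d * z := by
  have hd0 : d ≠ 0 := by
    rintro rfl
    exact Nat.card_pos.ne (by simpa only [zero_mul, mul_zero] using h)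
  refine ⟨∑ c : Kˣ with c ^ n = 1, ψ (a * c),
    IsIntegral.sum _ fun c _ => isIntegral_addChar (p := p) ψ _, ?_⟩
  unfold powSum
  rw [sum_eq_zero_add_sum_units]
  simp only [ne_eq, hd0, not_false_eq_true, zero_pow, mul_zero, AddChar.map_zero_eq_one]
  congr 1
  -- Group the nonzero `x` by `c = x ^ d`: each fibre has exactly `d` elements, which produces the
  -- factor `d`.
  rw [← Finset.sum_fiberwise_of_maps_to (s := (Finset.univ : Finset Kˣ))
    (t := Finset.univ.filter fun c : Kˣ => c ^ n = 1) (g := fun x => x ^ d)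
    (fun x _ => by simpa using (exists_pow_eq_iff h (x ^ d)).1 ⟨x, rfl⟩), Finset.mul_sum]
  refine Finset.sum_congr rfl fun c hc => ?_
  have hc : c ^ n = 1 := by simpa using hc
  have : ∀ x ∈ Finset.univ.filter (fun x : Kˣ => x ^ d = c),
      ψ (a * (x : K) ^ d) = ψ (a * c) := by
    intro x hx
    have hx : x ^ d = c := by simpa using hx
    rw [← hx, Units.val_pow_eq_pow_val]
  rw [Finset.sum_congr rfl this, Finset.sum_const, nsmul_eq_mul]
  congr 2
  conv_rhs => rw [← card_pow_eq h hc]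
  rw [Nat.card_eq_fintype_card, Fintype.card_subtype]

theorem units_neg_one_pow {p : ℕ} [Fact p.Prime] [CharP K p] {r u : ℕ} (hu : u = p ^ r) :
    (-1 : Kˣ) ^ (u + 1) = 1 ∧ (-1 : Kˣ) ^ (u - 1) = 1 := by
  rcases (Fact.out : p.Prime).eq_two_or_odd' with rfl | hp
  · have : (-1 : Kˣ) = 1 := by
      ext
      simpa using CharTwo.neg_eq (1 : K)
    simp [this]
  · have : Odd u := hu ▸ hp.pow
    exact ⟨(this.add_one).neg_one_pow, (Nat.Odd.sub_odd this odd_one).neg_one_pow⟩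

/-- Dividing by `a x` gives `(a x ^ (u + 1)) ^ (u - 1) = -1`. Raise this to the power `m`: the
factor in `x` disappears since `(u + 1) n` is the group order. -/
theorem units_pow_eq_of_exists {u n m : ℕ} (hu : 0 < u) (hn : n = (u - 1) * m)
    (h : (u + 1) * n = Nat.card Kˣ) (a : Kˣ) {x : K} (hx : x ≠ 0)
    (hax : (a : K) ^ u * x ^ u ^ 2 + a * x = 0) : a ^ n = (-1) ^ m := by
  obtain ⟨v, rfl⟩ : ∃ v, u = v + 1 := ⟨u - 1, by omega⟩
  have h1 : ((a : K) * x ^ (v + 1 + 1)) ^ v = -1 := by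
    have hne : (a : K) * x ≠ 0 := mul_ne_zero a.ne_zero hx
    apply mul_right_cancel₀ hne
    have e : x ^ (v + 1) ^ 2 = (x ^ (v + 1 + 1)) ^ v * x := by
      rw [← pow_mul, ← pow_succ]; congr 1; ring
    rw [e] at hax
    linear_combination hax
  have h2 : (a * (Units.mk0 x hx) ^ (v + 1 + 1)) ^ v = -1 := by
    ext; simpa using h1
  have h3 : (a * (Units.mk0 x hx) ^ (v + 1 + 1)) ^ n = (-1) ^ m := by
    rw [hn, Nat.add_sub_cancel, pow_mul, h2]
  rwa [mul_pow, ← pow_mul, h, pow_card_eq_one', mul_one] at h3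

/-- The equation makes `z` rational, hence an integer. Modulo `u + 1` one has `u ≡ -1`, so `1 ≡ ε
(-1) ^ k`, and `u + 1 ≥ 3` separates `1` from `-1`. -/
theorem eq_neg_one_pow_of_isIntegral {u k : ℕ} (hu : 2 ≤ u) {ε : ℤ} (hε : ε = 1 ∨ ε = -1) {z : ℂ}
    (hz : IsIntegral ℤ z) (h : (ε : ℂ) * u ^ k * (-u) = 1 + ((u + 1 : ℕ) : ℂ) * z) :
    ε = (-1) ^ k := by
  have hU : ((u + 1 : ℕ) : ℂ) ≠ 0 := by exact_mod_cast (Nat.succ_ne_zero u)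
  have hz' : z = ((((ε : ℚ) * u ^ k * (-u) - 1) / ((u + 1 : ℕ) : ℚ) : ℚ) : ℂ) := by
    push_cast
    push_cast at h hU
    rw [eq_div_iff hU]
    linear_combination -h
  have hq : IsIntegral ℤ (((ε : ℚ) * u ^ k * (-u) - 1) / ((u + 1 : ℕ) : ℚ)) := by
    rw [hz'] at hz
    exact (isIntegral_algebraMap_iff (A := ℚ) (B := ℂ) (algebraMap ℚ ℂ).injective).1 hz
  obtain ⟨w, hw⟩ := IsIntegrallyClosed.isIntegral_iff.1 hq
  have hw : ε * u ^ k * (-u) - 1 = (u + 1) * w := by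
    have hU' : ((u + 1 : ℕ) : ℚ) ≠ 0 := by exact_mod_cast (Nat.succ_ne_zero u)
    rw [eq_div_iff hU'] at hw
    have : (w : ℚ) * ((u + 1 : ℕ) : ℚ) = (ε : ℚ) * u ^ k * (-u) - 1 := by simpa using hw
    have : w * ((u + 1 : ℕ) : ℤ) = ε * u ^ k * (-u) - 1 := by exact_mod_cast this
    push_cast at this
    linarith
  have hmod : (u : ℤ) ≡ -1 [ZMOD (u + 1)] := by
    rw [Int.modEq_iff_dvd]; exact ⟨-1, by ring⟩
  have h1 : ε * u ^ k * (-u) ≡ ε * (-1) ^ k * (- -1) [ZMOD (u + 1)] :=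
    ((hmod.pow k).mul_left ε).mul hmod.neg
  have h2 : (1 : ℤ) ≡ ε * u ^ k * (-u) [ZMOD (u + 1)] := by
    rw [Int.modEq_iff_dvd]; exact ⟨w, hw⟩
  have h3 := (Int.modEq_iff_dvd.1 (h2.trans h1))
  rcases neg_one_pow_eq_or ℤ k with hk | hk <;> rcases hε with rfl | rfl <;> rw [hk] at h3 ⊢ <;>
    norm_num at h3 ⊢ <;> have := Int.le_of_dvd (by norm_num) h3 <;> omega

/-- Evaluation of the exponential sums of exponent `p ^ r + 1` over `𝔽_{p ^ (2 r k)}`. -/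
theorem powSum_add_one_eq {p : ℕ} [Fact p.Prime] [CharP K p] {ψ : AddChar K ℂ}
    (hψ : ψ.IsPrimitive) (hfrob : ∀ z, ψ (z ^ p) = ψ z) {r u k n m : ℕ} (hu : u = p ^ r)
    (hu2 : 2 ≤ u) (hK : Fintype.card K = (u ^ k) ^ 2) (hn : n = (u - 1) * m)
    (h : (u + 1) * n = Nat.card Kˣ) (a : Kˣ) :
    powSum ψ (u + 1) (a : K) = (-1) ^ k * u ^ k * (if a ^ n = (-1) ^ m then -(u : ℂ) else 1) := by
  have hnpos : 0 < n := Nat.pos_of_ne_zero (by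
    rintro rfl
    exact Nat.card_pos.ne (by simpa only [zero_mul, mul_zero] using h))
  obtain ⟨hU, hU'⟩ := units_neg_one_pow (K := K) hu
  have hneg : ∀ a : Kˣ, powSum ψ (u + 1) (-(a : K)) = powSum ψ (u + 1) (a : K) := by
    intro a
    rw [← Units.val_neg]
    refine powSum_eq_of_pow_eq ψ h ?_
    rw [neg_pow, hn, pow_mul (-1 : Kˣ), hU', one_pow, one_mul]
  have hreal : ∀ a : Kˣ, powSum ψ (u + 1) (a : K) = ((powSum ψ (u + 1) (a : K)).re : ℂ) := by
    intro a
    refine (Complex.conj_eq_iff_re.1 ?_).symm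
    rw [conj_powSum, hneg]
  have hcardK : (Fintype.card K : ℂ) = ((((u : ℝ) ^ k) ^ 2 : ℝ) : ℂ) := by rw [hK]; push_cast; rfl
  -- The exceptional class `a ^ n = (-1) ^ m` contains every `a` whose linearised polynomial has a
  -- nonzero root.
  obtain ⟨ε, hε, hval⟩ := two_valued_of_moments (fun a : Kˣ => a ^ n = (-1) ^ m) hnpos
    (u := (u : ℝ)) (R := (u : ℝ) ^ k) (by positivity)
    (fun a => (powSum ψ (u + 1) (a : K)).re)
    (by rw [← Nat.card_eq_fintype_card, ← h]; push_cast; ring)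
    (by
      rw [← Fintype.card_subtype, ← Nat.card_eq_fintype_card]
      refine card_pow_eq (m := u + 1) (by rw [mul_comm, h]) ?_
      rw [← pow_mul, mul_comm, pow_mul, hU, one_pow])
    (fun a b ha hb => by rw [powSum_eq_of_pow_eq ψ h (ha.trans hb.symm)])
    (fun a ha => by
      have := powSum_mul_powSum_neg hψ hfrob hu (a := (a : K)) fun x hx hax =>
        ha (units_pow_eq_of_exists (by omega) hn h a hx hax)
      rw [hneg, hreal, hcardK] at this
      rw [sq]
      exact_mod_cast this)
    (by
      have := sum_units_powSum hψ (Nat.succ_ne_zero u)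
      rw [Finset.sum_congr rfl fun a _ => hreal a] at this
      exact_mod_cast this)
    (by
      have := sum_units_powSum_mul_neg hψ (Dvd.intro _ h)
      rw [Finset.sum_congr rfl fun (a : Kˣ) _ =>
        (by rw [hneg, hreal, ← sq, Complex.ofReal_re] :
          powSum ψ (u + 1) (a : K) * powSum ψ (u + 1) (-(a : K)) =
            ((powSum ψ (u + 1) (a : K)).re : ℂ) ^ 2), hcardK, ← h] at this
      have h2 : (∑ a : Kˣ, (powSum ψ (u + 1) (a : K)).re ^ 2 : ℝ) =
          ((u : ℝ) ^ k) ^ 2 * (((u + 1 : ℕ) * n : ℕ) * ((u + 1 : ℕ) - 1)) := by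
        exact_mod_cast this
      rw [h2]; push_cast; ring)
  have hval' : ∀ a : Kˣ, powSum ψ (u + 1) (a : K) =
      ε * u ^ k * (if a ^ n = (-1) ^ m then -(u : ℂ) else 1) := by
    intro a
    rw [hreal, hval]
    split_ifs <;> push_cast <;> rfl
  -- One exceptional `a₀` suffices to determine the sign, through the congruence of its sum to `1`
  -- modulo `u + 1`.
  obtain ⟨a₀, ha₀⟩ := (exists_pow_eq_iff (n := n) (m := u + 1) (by rw [mul_comm, h])
    ((-1 : Kˣ) ^ m)).2 (by rw [← pow_mul, mul_comm, pow_mul, hU, one_pow])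
  obtain ⟨z, hz, hz'⟩ := exists_isIntegral_powSum (p := p) ψ h (a₀ : K)
  have := hval' a₀
  rw [if_pos ha₀, hz'] at this
  rw [hval', eq_neg_one_pow_of_isIntegral hu2 hε hz this.symm]
  push_cast
  rfl

end SemiPrimitive

open scoped LinearAlgebra.Projectivization

/-! ### From exponential sums to projective point counts. -/

section PointCount

set_option linter.unusedSectionVars false

theorem nonZeroEquivProjectivizationProdUnits_fst {k V : Type*} [DivisionRing k] [AddCommGroup V]
    [Module k V] (v : {v : V // v ≠ 0}) :
    (Projectivization.nonZeroEquivProjectivizationProdUnits k V v).1 =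
      Projectivization.mk k v.1 v.2 :=
  rfl

variable {K : Type*} [Field K] [Fintype K] [DecidableEq K]

theorem mk_mem_hypersurfacePoints_diagonalForm {F : Type*} [Field F] [Algebra F K] {d s : ℕ}
    (v : Fin (s + 1) → K) (hv : v ≠ 0) :
    Projectivization.mk K v hv ∈ hypersurfacePoints (diagonalForm F d s) K ↔
      ∑ i, v i ^ d = 0 := by
  simp only [hypersurfacePoints, diagonalForm, Set.mem_ofPred_eq, Projectivization.submodule_mk,
    Submodule.mem_span_singleton, map_sum, map_pow, MvPolynomial.aeval_X]
  constructor
  · intro h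
    exact h v ⟨1, one_smul _ _⟩
  · rintro h _ ⟨c, rfl⟩
    simp [mul_pow, ← Finset.mul_sum, h]

/-- Affine and projective solutions of a diagonal equation. -/
theorem card_diagonal_eq {F : Type*} [Field F] [Algebra F K] {d s : ℕ} (hd : d ≠ 0) :
    Nat.card {v : Fin (s + 1) → K // ∑ i, v i ^ d = 0} =
      Nat.card (hypersurfacePoints (diagonalForm F d s) K) * Nat.card Kˣ + 1 := by
  have h0 : ∑ i, (0 : Fin (s + 1) → K) i ^ d = 0 := by simp [hd]
  have e₁ : {v : {v : Fin (s + 1) → K // v ≠ 0} // ∑ i, v.1 i ^ d = 0} ≃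
      hypersurfacePoints (diagonalForm F d s) K × Kˣ :=
    ((Projectivization.nonZeroEquivProjectivizationProdUnits K (Fin (s + 1) → K)).subtypeEquiv
      (q := fun x => x.1 ∈ hypersurfacePoints (diagonalForm F d s) K) fun v => by
        rw [nonZeroEquivProjectivizationProdUnits_fst,
          mk_mem_hypersurfacePoints_diagonalForm]).trans
      Equiv.prodSubtypeFstEquivSubtypeProd
  have e₂ : {v : {v : Fin (s + 1) → K // v ≠ 0} // ∑ i, v.1 i ^ d = 0} ≃
      {v : {v : Fin (s + 1) → K // ∑ i, v i ^ d = 0} // v ≠ ⟨0, h0⟩} :=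
    (Equiv.subtypeSubtypeEquivSubtypeInter (fun v : Fin (s + 1) → K => v ≠ 0)
      (fun v => ∑ i, v i ^ d = 0)).trans <|
    (Equiv.subtypeEquivRight fun v => and_comm).trans <|
    (Equiv.subtypeSubtypeEquivSubtypeInter (fun v : Fin (s + 1) → K => ∑ i, v i ^ d = 0)
      (fun v => v ≠ 0)).symm.trans <|
    Equiv.subtypeEquivRight fun v => by rw [ne_eq, ne_eq, Subtype.ext_iff]
  rw [← Nat.card_prod, ← Nat.card_congr e₁, Nat.card_congr e₂, Nat.card_eq_fintype_card,
    Nat.card_eq_fintype_card, Fintype.card_subtype_compl, Fintype.card_subtype_eq]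
  have : 0 < Fintype.card {v : Fin (s + 1) → K // ∑ i, v i ^ d = 0} :=
    Fintype.card_pos_iff.2 ⟨⟨0, h0⟩⟩
  omega

/-- Averaging the power sums of exponent `d * e` over the `d`-th powers. -/
theorem sum_powSum_mul_pow (ψ : AddChar K ℂ) {d e : ℕ} (hd : d ≠ 0) (he : e ≠ 0) (a : K) :
    ∑ y : Kˣ, (powSum ψ (d * e) (a * (y : K) ^ d) - 1) = Nat.card Kˣ * (powSum ψ d a - 1) := by
  have hsub : ∀ (n : ℕ) (b : K), n ≠ 0 → powSum ψ n b - 1 = ∑ x : Kˣ, ψ (b * (x : K) ^ n) := by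
    intro n b hn
    rw [powSum, sum_eq_zero_add_sum_units]
    simp [hn]
  simp_rw [hsub _ _ (mul_ne_zero hd he), hsub _ _ hd]
  rw [Finset.sum_comm]
  have : ∀ x : Kˣ, ∑ y : Kˣ, ψ (a * (y : K) ^ d * (x : K) ^ (d * e)) =
      ∑ y : Kˣ, ψ (a * (y : K) ^ d) := by
    intro x
    -- Substituting `y x ^ e` for `y` absorbs `x ^ (d * e)`.
    refine Fintype.sum_equiv (Equiv.mulRight (x ^ e)) _ _ fun y => ?_
    congr 1
    simp only [Equiv.coe_mulRight, Units.val_mul, Units.val_pow_eq_pow_val]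
    ring
  simp_rw [this]
  rw [Finset.sum_const, Finset.card_univ, nsmul_eq_mul, Nat.card_eq_fintype_card]

/-- Evaluation of the power sums of an exponent dividing `p ^ r + 1` over `𝔽_{p ^ (2 r k)}`. -/
theorem powSum_eq {p : ℕ} [Fact p.Prime] [CharP K p] {ψ : AddChar K ℂ}
    (hψ : ψ.IsPrimitive) (hfrob : ∀ z, ψ (z ^ p) = ψ z) {r u k n m d e : ℕ} (hu : u = p ^ r)
    (hu2 : 2 ≤ u) (hK : Fintype.card K = (u ^ k) ^ 2) (hn : n = (u - 1) * m)
    (h : (u + 1) * n = Nat.card Kˣ) (hde : d * e = u + 1) (a : Kˣ) :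
    powSum ψ d (a : K) =
      (-1) ^ k * u ^ k * (if a ^ (e * n) = ((-1) ^ m) ^ e then 1 - (d : ℂ) else 1) := by
  have hd0 : d ≠ 0 := by rintro rfl; omega
  have he0 : e ≠ 0 := by rintro rfl; omega
  have hpos : (Nat.card Kˣ : ℂ) ≠ 0 := by exact_mod_cast Nat.card_pos.ne'
  have havg := sum_powSum_mul_pow ψ hd0 he0 (a : K)
  have hterm : ∀ y : Kˣ, powSum ψ (d * e) ((a : K) * (y : K) ^ d) - 1 = ((-1) ^ k * u ^ k - 1) -
      (-1) ^ k * u ^ k * (u + 1) * (if y ^ (d * n) = (-1) ^ m * (a ^ n)⁻¹ then 1 else 0) := by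
    intro y
    have hiff : y ^ (d * n) = (-1) ^ m * (a ^ n)⁻¹ ↔ (a * y ^ d) ^ n = (-1) ^ m := by
      rw [eq_mul_inv_iff_mul_eq, mul_pow, ← pow_mul, mul_comm]
    rw [← Units.val_pow_eq_pow_val, ← Units.val_mul, hde,
      powSum_add_one_eq hψ hfrob hu hu2 hK hn h]
    simp only [hiff]
    split_ifs <;> ring
  -- Number of `y` moving `a` into the exceptional class of exponent `u + 1`: an equation `y ^ (d n)
  -- = c` has `d n` solutions or none.
  have hcount : (∑ y : Kˣ, if y ^ (d * n) = (-1) ^ m * (a ^ n)⁻¹ then (1 : ℂ) else 0) =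
      if a ^ (e * n) = ((-1) ^ m) ^ e then ((d * n : ℕ) : ℂ) else 0 := by
    have hdn : d * n * e = Nat.card Kˣ := by rw [← h, ← hde]; ring
    have hiff : a ^ (e * n) = ((-1) ^ m) ^ e ↔ ((-1) ^ m * (a ^ n)⁻¹) ^ e = 1 := by
      rw [mul_pow, inv_pow, mul_inv_eq_one, mul_comm e n, pow_mul, eq_comm]
    rw [Finset.sum_boole]
    split_ifs with hc
    · rw [← Fintype.card_subtype, ← Nat.card_eq_fintype_card, card_pow_eq hdn (hiff.1 hc)]
    · rw [Finset.filter_eq_empty_iff.2 fun y _ hy =>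
        hc (hiff.2 ((exists_pow_eq_iff hdn _).1 ⟨y, hy⟩))]
      simp
  simp_rw [hterm] at havg
  rw [Finset.sum_sub_distrib, ← Finset.mul_sum, hcount, Finset.sum_const, Finset.card_univ,
    ← Nat.card_eq_fintype_card, nsmul_eq_mul] at havg
  have hcast : (Nat.card Kˣ : ℂ) = (u + 1) * n := by rw [← h]; push_cast; ring
  apply mul_left_cancel₀ hpos
  split_ifs at havg ⊢
  · push_cast at havg
    linear_combination -havg + (-1) ^ k * u ^ k * d * hcast
  · linear_combination -havg

theorem exists_card_units_eq {u k : ℕ} (hK : Fintype.card K = (u ^ k) ^ 2) :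
    ∃ m, (u + 1) * ((u - 1) * m) = Nat.card Kˣ := by
  have h1 : Nat.card Kˣ = (u ^ 2) ^ k - 1 ^ k := by
    rw [Nat.card_eq_fintype_card, Fintype.card_units, hK, one_pow, ← pow_mul, ← pow_mul, mul_comm]
  obtain ⟨m, hm⟩ := Nat.sub_dvd_pow_sub_pow (u ^ 2) 1 k
  refine ⟨m, ?_⟩
  rw [h1, hm, ← mul_assoc]
  congr 1
  have := Nat.sq_sub_sq u 1
  simpa using this.symm

theorem card_hypersurfacePoints_diagonalForm {F : Type*} [Field F] [Algebra F K] {p : ℕ}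
    [Fact p.Prime] [CharP K p] {r u k d s : ℕ} (hu : u = p ^ r) (hu2 : 2 ≤ u)
    (hK : Fintype.card K = (u ^ k) ^ 2) (hd : d ∣ u + 1) (hs : 1 ≤ s) :
    (Nat.card (hypersurfacePoints (diagonalForm F d s) K) : ℚ) =
      ∑ i ∈ Finset.range s, ((u : ℚ) ^ k) ^ (2 * i) +
        (-1) ^ ((k + 1) * (s + 1)) * ((u : ℚ) ^ k) ^ (s - 1) * B d (s + 1) := by
  obtain ⟨e, hde⟩ := hd
  have hde := hde.symm
  have hd0 : d ≠ 0 := by rintro rfl; omega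
  obtain ⟨m, hm⟩ := exists_card_units_eq hK
  obtain ⟨n, hn⟩ : ∃ n, n = (u - 1) * m := ⟨_, rfl⟩
  rw [← hn] at hm
  obtain ⟨ψ, hψ, hfrob⟩ := exists_frobenius_invariant_addChar K p
  have hcount := card_mul_card_diagonal hψ d (s + 1)
  rw [card_diagonal_eq (F := F) hd0, sum_eq_zero_add_sum_units, powSum_zero] at hcount
  have hdn : d * (e * n) = Nat.card Kˣ := by rw [← mul_assoc, hde, hm]
  have hfilter : (Finset.univ.filter fun a : Kˣ => a ^ (e * n) = ((-1) ^ m) ^ e).card = e * n := by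
    rw [← Fintype.card_subtype, ← Nat.card_eq_fintype_card]
    refine card_pow_eq (m := d) (by rw [mul_comm, hdn]) ?_
    rw [← pow_mul, mul_comm e d, hde, ← pow_mul, mul_comm, pow_mul, (units_neg_one_pow hu).1,
      one_pow]
  have hsum : ∑ a : Kˣ, powSum ψ d (a : K) ^ (s + 1) =
      ((-1) ^ k * u ^ k) ^ (s + 1) *
        ((Nat.card Kˣ : ℂ) + ((e * n : ℕ) : ℂ) * ((1 - d) ^ (s + 1) - 1)) := by
    have : ∀ a : Kˣ, powSum ψ d (a : K) ^ (s + 1) = ((-1) ^ k * u ^ k) ^ (s + 1) * (1 +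
        ((1 - d) ^ (s + 1) - 1) * (if a ^ (e * n) = ((-1) ^ m) ^ e then 1 else 0)) := by
      intro a
      rw [powSum_eq hψ hfrob hu hu2 hK hn hm hde, mul_pow]
      split_ifs <;> ring
    simp_rw [this]
    rw [← Finset.mul_sum, Finset.sum_add_distrib, ← Finset.mul_sum, Finset.sum_boole, hfilter,
      Finset.sum_const, Finset.card_univ, ← Nat.card_eq_fintype_card, nsmul_eq_mul]
    ring
  rw [hsum] at hcount
  set N := Nat.card (hypersurfacePoints (diagonalForm F d s) K)
  have hQ : Nat.card Kˣ + 1 = Fintype.card K := by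
    rw [Nat.card_eq_fintype_card, ← Fintype.card_eq_card_units_add_one]
  have hQpos : (0 : ℚ) < Nat.card Kˣ := by exact_mod_cast Nat.card_pos
  have hcountQ : (Fintype.card K : ℚ) * (N * Nat.card Kˣ + 1) = (Fintype.card K : ℚ) ^ (s + 1) +
      ((-1) ^ k * u ^ k) ^ (s + 1) * ((Nat.card Kˣ : ℚ) + (e * n) * ((1 - d) ^ (s + 1) - 1)) := by
    exact_mod_cast hcount
  have hq : (Nat.card Kˣ : ℚ) = ((u : ℚ) ^ k) ^ 2 - 1 := by
    rw [eq_sub_iff_add_eq]; exact_mod_cast hQ.trans hK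
  have hdnQ : (d : ℚ) * (e * n) = Nat.card Kˣ := by exact_mod_cast hdn
  have hdQ : (d : ℚ) ≠ 0 := by exact_mod_cast hd0
  have hB : (d : ℚ) * B d (s + 1) = (d - 1) ^ (s + 1) + (-1) ^ (s + 1) * (d - 1) := by
    unfold B; field_simp
  -- The extra `d` comes from writing the unit count as `d (e n)`; it completes the deviation of the
  -- exceptional class to a multiple of `B`.
  have hneg : ((1 : ℚ) - d) ^ (s + 1) - 1 + d = (-1) ^ (s + 1) * (d * B d (s + 1)) := by
    have e1 : (1 - d : ℚ) ^ (s + 1) = (-1) ^ (s + 1) * (d - 1) ^ (s + 1) := by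
      rw [← mul_pow]; ring
    have e2 : ((-1 : ℚ) ^ (s + 1)) * (-1) ^ (s + 1) = 1 := by
      rw [← mul_pow]; norm_num
    rw [hB, e1]
    linear_combination -(d - 1 : ℚ) * e2
  have hgeom : (∑ i ∈ Finset.range s, ((u : ℚ) ^ k) ^ (2 * i)) * Nat.card Kˣ =
      (((u : ℚ) ^ k) ^ 2) ^ s - 1 := by
    simp_rw [pow_mul _ 2]
    rw [hq, geom_sum_mul]
  have hinner : (Nat.card Kˣ : ℚ) + (e * n) * ((1 - d) ^ (s + 1) - 1) =
      (-1) ^ (s + 1) * Nat.card Kˣ * B d (s + 1) := by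
    rw [← hdnQ]
    linear_combination (e * n : ℚ) * hneg
  have hKQ : (Fintype.card K : ℚ) = ((u : ℚ) ^ k) ^ 2 := by exact_mod_cast hK
  have hupos : ((u : ℚ) ^ k) ^ 2 ≠ 0 := by
    have : (u : ℚ) ≠ 0 := by exact_mod_cast (by omega : u ≠ 0)
    positivity
  obtain ⟨t, rfl⟩ : ∃ t, s = t + 1 := ⟨s - 1, by omega⟩
  rw [hinner, hKQ] at hcountQ
  have hsign : (-1 : ℚ) ^ ((k + 1) * (t + 1 + 1)) =
      ((-1) ^ k) ^ (t + 1 + 1) * (-1) ^ (t + 1 + 1) := by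
    rw [← mul_pow, ← pow_succ, ← pow_mul]
  rw [Nat.add_sub_cancel, hsign]
  apply mul_right_cancel₀ hQpos.ne'
  apply mul_left_cancel₀ hupos
  rw [mul_pow] at hcountQ
  linear_combination hcountQ - ((u : ℚ) ^ k) ^ 2 * hgeom

end PointCount

/-! ### Power series determined by their logarithmic derivatives. -/

section LogDerivative

open PowerSeries

variable {k : Type*} [Field k]

/-- The quotient of the two series has zero derivative and constant term `1`. -/
theorem eq_of_derivative_eq_mul [CharZero k] {Y₁ Y₂ G : k⟦X⟧}
    (h₁ : d⁄dX k Y₁ = Y₁ * G) (h₂ : d⁄dX k Y₂ = Y₂ * G)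
    (c₁ : constantCoeff Y₁ = 1) (c₂ : constantCoeff Y₂ = 1) : Y₁ = Y₂ := by
  have hne : constantCoeff Y₂ ≠ 0 := by rw [c₂]; exact one_ne_zero
  have : Y₁ * Y₂⁻¹ = 1 := by
    apply derivative.ext
    · rw [Derivation.leibniz, derivative_inv', h₁, h₂, derivative_one, smul_eq_mul, smul_eq_mul]
      linear_combination (-(Y₁ * Y₂⁻¹ * G)) * PowerSeries.mul_inv_cancel Y₂ hne
    · simp [c₁, c₂]
  calc Y₁ = Y₁ * Y₂⁻¹ * Y₂ := by rw [mul_assoc, PowerSeries.inv_mul_cancel _ hne, mul_one]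
    _ = Y₂ := by rw [this, one_mul]

theorem derivative_mul_eq_mul {Y₁ Y₂ G₁ G₂ : k⟦X⟧} (h₁ : d⁄dX k Y₁ = Y₁ * G₁)
    (h₂ : d⁄dX k Y₂ = Y₂ * G₂) : d⁄dX k (Y₁ * Y₂) = Y₁ * Y₂ * (G₁ + G₂) := by
  rw [Derivation.leibniz, h₁, h₂, smul_eq_mul, smul_eq_mul]
  ring

theorem derivative_inv_eq_mul {Y G : k⟦X⟧} (h : d⁄dX k Y = Y * G)
    (hc : constantCoeff Y ≠ 0) : d⁄dX k Y⁻¹ = Y⁻¹ * -G := by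
  rw [derivative_inv', h]
  linear_combination -(Y⁻¹ * G) * PowerSeries.mul_inv_cancel Y hc

theorem derivative_pow_eq_mul {Y G : k⟦X⟧} (h : d⁄dX k Y = Y * G) (n : ℕ) :
    d⁄dX k (Y ^ n) = Y ^ n * (n * G) := by
  induction n with
  | zero => simp
  | succ n ih =>
    rw [pow_succ, derivative_mul_eq_mul ih h]
    push_cast
    ring

theorem derivative_prod_eq_mul {ι : Type*} (s : Finset ι) {Y G : ι → k⟦X⟧}
    (h : ∀ i ∈ s, d⁄dX k (Y i) = Y i * G i) :
    d⁄dX k (∏ i ∈ s, Y i) = (∏ i ∈ s, Y i) * ∑ i ∈ s, G i := by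
  classical
  induction s using Finset.induction_on with
  | empty => simp
  | insert i s hi ih =>
    rw [Finset.prod_insert hi, Finset.sum_insert hi]
    exact derivative_mul_eq_mul (h i (Finset.mem_insert_self i s))
      (ih fun j hj => h j (Finset.mem_insert_of_mem hj))

theorem derivative_one_sub_C_mul_X (c : k) :
    d⁄dX k (1 - C c * X) = (1 - C c * X) * -(PowerSeries.mk fun n => c ^ (n + 1)) := by
  have h1 : d⁄dX k (1 - C c * X) = -C c := by
    rw [map_sub, derivative_one, Derivation.leibniz, derivative_X, derivative_C]
    simp
  rw [h1]
  ext n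
  rw [mul_neg, map_neg, map_neg, sub_mul, one_mul, mul_assoc, map_sub, coeff_C_mul, coeff_mk,
    coeff_C]
  cases n with
  | zero => simp
  | succ n => rw [coeff_succ_X_mul, coeff_mk]; simp [pow_succ']

theorem derivative_exp_subst {L : ℚ⟦X⟧} (hL : constantCoeff L = 0) :
    d⁄dX ℚ ((exp ℚ).subst L) = (exp ℚ).subst L * d⁄dX ℚ L := by
  rw [derivative_subst (HasSubst.of_constantCoeff_zero' hL), derivative_exp]

theorem constantCoeff_exp_subst {L : ℚ⟦X⟧} (hL : constantCoeff L = 0) :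
    constantCoeff ((exp ℚ).subst L) = 1 := by
  have h := constantCoeff_subst (HasSubst.of_constantCoeff_zero' hL) (exp ℚ)
  rw [finsum_eq_single _ 0 fun n hn => by
    have : MvPowerSeries.constantCoeff L = 0 := hL
    simp [this, hn]] at h
  exact h.trans (by simp)

end LogDerivative

/-- With `c = d - 1`, integrality follows from `c ≡ -1` modulo `d`, and non-negativity from `c ≤ c ^
(s + 1)`. -/
theorem exists_nat_eq_B {d s : ℕ} (hd : d ≠ 0) (hs : 1 ≤ s) :
    ∃ b : ℕ, (b : ℚ) = B d (s + 1) := by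
  obtain ⟨c, rfl⟩ : ∃ c, d = c + 1 := ⟨d - 1, by omega⟩
  have hdvd : ((c + 1 : ℕ) : ℤ) ∣ (c : ℤ) ^ (s + 1) + (-1) ^ (s + 1) * c := by
    have h1 : (c : ℤ) ≡ -1 [ZMOD ((c + 1 : ℕ) : ℤ)] := by
      rw [Int.modEq_iff_dvd]; exact ⟨-1, by push_cast; ring⟩
    have h2 := (h1.pow (s + 1)).add (h1.mul_left ((-1) ^ (s + 1)))
    have h3 : (-1 : ℤ) ^ (s + 1) + (-1) ^ (s + 1) * -1 = 0 := by ring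
    rw [h3] at h2
    exact Int.modEq_zero_iff_dvd.1 h2
  have hnonneg : 0 ≤ (c : ℤ) ^ (s + 1) + (-1) ^ (s + 1) * c := by
    have hle : (c : ℤ) ≤ (c : ℤ) ^ (s + 1) := by exact_mod_cast Nat.le_self_pow (by omega) c
    rcases neg_one_pow_eq_or ℤ (s + 1) with h | h <;> rw [h] <;> linarith
  obtain ⟨w, hw⟩ := hdvd
  have hw0 : 0 ≤ w := by
    rw [hw] at hnonneg
    exact nonneg_of_mul_nonneg_right hnonneg (by positivity)
  obtain ⟨b, rfl⟩ := Int.eq_ofNat_of_zero_le hw0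
  refine ⟨b, ?_⟩
  unfold B
  have hw' : (c : ℚ) ^ (s + 1) + (-1) ^ (s + 1) * c = ((c + 1 : ℕ) : ℚ) * b := by exact_mod_cast hw
  rw [eq_div_iff (by exact_mod_cast Nat.succ_ne_zero c)]
  push_cast at hw' ⊢
  rw [add_sub_cancel_right, hw']
  ring

/-! ### The zeta function through its logarithmic derivative. -/

section Zeta

open PowerSeries

variable {p r d s : ℕ} [Fact p.Prime] {F : Type*} [Field F] [Finite F] [CharP F p]

/-- Each term is arranged as a `k`-th power, to match the coefficients from
`derivative_one_sub_C_mul_X`. -/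
theorem pointCount_diagonalForm (hF : Nat.card F = p ^ (2 * r)) (hd : d ∣ p ^ r + 1) (hs : 1 ≤ s)
    (k : ℕ) [NeZero k] :
    (pointCount p (diagonalForm F d s) k : ℚ) =
      ∑ i ∈ Finset.range s, (((p : ℚ) ^ (2 * r)) ^ i) ^ k +
        (-1) ^ ((k + 1) * (s + 1)) * ((p : ℚ) ^ (r * (s - 1))) ^ k * B d (s + 1) := by
  classical
  have := Fintype.ofFinite (FiniteField.Extension F p k)
  have : CharP (FiniteField.Extension F p k) p :=
    charP_of_injective_algebraMap (algebraMap F _).injective p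
  -- For `r = 0` the field would have a single element.
  have hr : r ≠ 0 := by
    rintro rfl
    have := Finite.one_lt_card (α := F)
    rw [hF] at this
    simp at this
  have hu2 : 2 ≤ p ^ r := (Fact.out : p.Prime).two_le.trans (Nat.le_self_pow hr p)
  unfold pointCount
  rw [card_hypersurfacePoints_diagonalForm (p := p) (k := k) rfl hu2
    (by rw [← Nat.card_eq_fintype_card, FiniteField.natCard_extension, hF]; ring) hd hs]
  push_cast
  simp only [← pow_mul]
  congr 1
  · exact Finset.sum_congr rfl fun i _ => by ring
  · congr 3; ring

theorem derivative_zeta (f : MvPolynomial (Fin (s + 1)) F) :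
    d⁄dX ℚ (zeta p f) = zeta p f * PowerSeries.mk fun n => (pointCount p f (n + 1) : ℚ) := by
  have hc : constantCoeff (logZeta p f) = 0 := by
    simp [logZeta, ← PowerSeries.coeff_zero_eq_constantCoeff_apply]
  unfold zeta
  rw [derivative_exp_subst hc]
  congr 1
  ext n
  rw [coeff_derivative, logZeta, coeff_mk, coeff_mk]
  push_cast
  field_simp

theorem constantCoeff_zeta (f : MvPolynomial (Fin (s + 1)) F) :
    constantCoeff (zeta p f) = 1 :=
  constantCoeff_exp_subst (by simp [logZeta, ← PowerSeries.coeff_zero_eq_constantCoeff_apply])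

theorem zeta_eq_of_derivative {f : MvPolynomial (Fin (s + 1)) F} {Y G : ℚ⟦X⟧}
    (hY : d⁄dX ℚ Y = Y * G) (hc : constantCoeff Y = 1)
    (hG : ∀ n, coeff n G = (pointCount p f (n + 1) : ℚ)) : zeta p f = Y := by
  refine eq_of_derivative_eq_mul (derivative_zeta f) ?_ (constantCoeff_zeta f) hc
  rw [hY]
  congr 1
  ext n
  rw [hG, coeff_mk]

end Zeta

end DiagonalZeta

theorem theorem3p2 (p r d s : ℕ) [Fact p.Prime] (F : Type*) [Field F] [Finite F] [CharP F p]
    (hF : Nat.card F = p ^ (2 * r)) (hd : d ∣ p ^ r + 1) (hs : 1 ≤ s) :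
    ∃ b : ℕ, (b : ℚ) = DiagonalZeta.B d (s + 1) ∧
      (Even s →
        DiagonalZeta.zeta p (DiagonalZeta.diagonalForm F d s) =
          (1 + PowerSeries.C ((p : ℚ) ^ (r * (s - 1))) * PowerSeries.X) ^ b *
            (∏ i ∈ Finset.range s,
              (1 - PowerSeries.C (((p : ℚ) ^ (2 * r)) ^ i) * PowerSeries.X))⁻¹) ∧
      (Odd s →
        DiagonalZeta.zeta p (DiagonalZeta.diagonalForm F d s) =
          ((1 - PowerSeries.C ((p : ℚ) ^ (r * (s - 1))) * PowerSeries.X) ^ b *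
            ∏ i ∈ Finset.range s,
              (1 - PowerSeries.C (((p : ℚ) ^ (2 * r)) ^ i) * PowerSeries.X))⁻¹) := by
  obtain ⟨b, hb⟩ := DiagonalZeta.exists_nat_eq_B (d := d) (s := s)
    (by rintro rfl; simp at hd) hs
  refine ⟨b, hb, fun hev => ?_, fun hodd => ?_⟩
  -- Negating the constant lets one derivative formula serve both parities.
  · have e : (1 : PowerSeries ℚ) + PowerSeries.C ((p : ℚ) ^ (r * (s - 1))) * PowerSeries.X =
        1 - PowerSeries.C (-(p : ℚ) ^ (r * (s - 1))) * PowerSeries.X := by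
      rw [map_neg]; ring
    rw [e]
    refine DiagonalZeta.zeta_eq_of_derivative
      (DiagonalZeta.derivative_mul_eq_mul
        (DiagonalZeta.derivative_pow_eq_mul (DiagonalZeta.derivative_one_sub_C_mul_X _) b)
        (DiagonalZeta.derivative_inv_eq_mul
          (DiagonalZeta.derivative_prod_eq_mul _ fun i _ =>
            DiagonalZeta.derivative_one_sub_C_mul_X _) (by simp [map_prod]))) (by simp [map_prod])
      fun n => ?_
    rw [DiagonalZeta.pointCount_diagonalForm hF hd hs, ← hb, ← map_natCast PowerSeries.C b]
    simp only [map_add, map_neg, map_sum, PowerSeries.coeff_C_mul, PowerSeries.coeff_mk,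
      Finset.sum_neg_distrib, neg_neg]
    -- Here `k = n + 1` and `s + 1` is odd, so the sign alternates with `k` and is absorbed by the
    -- `k`-th power of the negated constant.
    have hsign : (-1 : ℚ) ^ ((n + 1 + 1) * (s + 1)) = -(-1) ^ (n + 1) := by
      rw [mul_comm, pow_mul, (hev.add_one).neg_one_pow, pow_succ]; ring
    rw [hsign, neg_pow ((p : ℚ) ^ (r * (s - 1)))]
    ring
  · refine DiagonalZeta.zeta_eq_of_derivative
      (DiagonalZeta.derivative_inv_eq_mul (DiagonalZeta.derivative_mul_eq_mul
        (DiagonalZeta.derivative_pow_eq_mul (DiagonalZeta.derivative_one_sub_C_mul_X _) b)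
          (DiagonalZeta.derivative_prod_eq_mul _ fun i _ =>
            DiagonalZeta.derivative_one_sub_C_mul_X _)) (by simp [map_prod])) (by simp [map_prod])
      fun n => ?_
    rw [DiagonalZeta.pointCount_diagonalForm hF hd hs, ← hb, ← map_natCast PowerSeries.C b]
    simp only [map_add, map_neg, map_sum, PowerSeries.coeff_C_mul, PowerSeries.coeff_mk,
      Finset.sum_neg_distrib]
    have hsign : (-1 : ℚ) ^ ((n + 1 + 1) * (s + 1)) = 1 := by
      rw [mul_comm, pow_mul, (hodd.add_one).neg_one_pow, one_pow]
    rw [hsign]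
    ring
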